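/- Let $l\ge 1$, and let $A=(a_{ij})_{i,j\in\mathbb Z_{2l}}$ be the generalized Cartan matrix of type $A_{2l-1}^{(1)}$: its diagram is the cycle with vertex set $\mathbb Z_{2l}$ in which $i$ is adjacent to $i\pm1$, with $a_{ii}=2$, $a_{ij}=-1$ for adjacent $i\neq j$ and $a_{ij}=0$ otherwise (for $l=1$: $a_{01}=a_{10}=-2$). Let $W$ be its Weyl group, with generators $s_i$ $(i\in\mathbb Z_{2l})$ and relations $s_i^2=1$; $s_is_j=s_js_i$ if $a_{ij}=0$; $s_is_js_i=s_js_is_j$ if $i\neq j$ and $a_{ij}a_{ji}=1$. Let $W_0=\langle s_i: i\neq 0\rangle$ be the finite Weyl group of type $A_{2l-1}$. Let $E$ be the set of all $(p,k)\in\mathbb Z_{2l}\times\mathbb Z$ with $p\equiv k \pmod 2$, where $(p,k)$ has label $p$ and lies in layer $k$, partially ordered by the reflexive transitive closure of the relation "$(p,k)$ is related to $(q,m)$ if $k<m$ and $p,q$ are equal or adjacent". This is a full heap over the diagram (a fibred labelled heap such that between any two consecutive elements of the same label $p$ one has $\sum_{\gamma}a_{p,\varepsilon(\gamma)}=-2$,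 where $\varepsilon(\gamma)$ is the label of $\gamma$), and the layer is a rank function on it. Let $\mathcal B$ be the set of proper ideals of $E$, that is, of order ideals $F$ such that for every label $p$ some but not all elements labelled $p$ lie in $F$. For $i\in\mathbb Z_{2l}$ and $F\in\mathcal B$ let $S_i(F)$ be the ideal obtained from $F$ by removing an element labelled $i$ if this leaves an ideal, by adding an element labelled $i$ if this gives an ideal, and $S_i(F)=F$ otherwise (in each case the element is unique). Then $s_i\cdot F=S_i(F)$ defines an action of $W$ on $\mathcal B$. Let $\mathbf 2_+^{\mathbb Z_{2l}}$ be the set of functions $x:\mathbb Z_{2l}\to\{+,-\}$ with $|x^{-1}(+)|=|x^{-1}(-)|$, written as sequences $(x(0),x(1),\dots,x(2l-1))$. For $F\in\mathcal B$ let $h(F)=\max\{t\in\mathbb Z:(0,2t)\in F\}$, let $g(F,i)=\max\{y:(i,y)\in F\}+1$, and let $\sigma(F)$ be the string whose symbol at position $i$ is $+$ if $g(F,i+1)>g(F,i)$ and $-$ if $g(F,i+1)<g(F,i)$. Then $\Psi: F\mapsto(h(F),\sigma(F))$ is a bijection from $\mathcal B$ to $\mathbb Z\times\mathbf 2_+^{\mathbb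 Z_{2l}}$, and $\Psi^{-1}(t,x)=\phi^t(\Psi^{-1}(0,x))$, where $\phi(p,k)=(p,k+2)$. Via $\Psi$, the action of $W$ on $\mathcal B$ induces an action of $W_0$ on $\mathbf 2_+^{\mathbb Z_{2l}}$ (so $\Psi(w\cdot F)=(h(F),w\cdot\sigma(F))$ for $w\in W_0$), which is transitive and faithful, and in which $s_i$, for $i\not\equiv0 \bmod 2l$, exchanges the symbols at positions $i-1$ and $i$. This extends to a faithful action of $W$ on $\mathbb Z\times\mathbf 2_+^{\mathbb Z_{2l}}$, namely the one transported from $\mathcal B$ by $\Psi$: each $w\in W_0$ acts as $(\mathrm{id},w)$, in particular $s_i$ acts as $(\mathrm{id},s_i)$ for $i\not\equiv 0\bmod 2l$, and $s_0$ acts as follows, where $\mathbf s'$ denotes the string with its first and last symbols deleted: $$s_0(t,+\mathbf s'-)=(t+1,-\mathbf s'+),\qquad s_0(t,-\mathbf s'+)=(t-1,+\mathbf s'-),$$ $$s_0(t,+\mathbf s'+)=(t,+\mathbf s'+),\qquad s_0(t,-\mathbf s'-)=(t,-\mathbf s'-).$$ -/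

import Mathlib

/-! Heaps over Dynkin diagrams, for a poset `E` labelled by the vertices `P` of the diagram of a
generalized Cartan matrix `A`.  Two vertices `p`, `q` are equal or adjacent iff `A p q ≠ 0`. -/

section GeneralHeaps

/-- `(E, ≤, ε)` is a labelled heap over the Dynkin diagram of `A`. -/
structure IsLabelledHeap {P E : Type*} [PartialOrder E] (A : Matrix P P ℤ) (ε : E → P) :
    Prop where
  locallyFinite : ∀ a b : E, (Set.Icc a b).Finite
  comparable : ∀ a b : E, A (ε a) (ε b) ≠ 0 → a ≤ b ∨ b ≤ a
  generated : ∀ a b : E, a ≤ b →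
    Relation.TransGen (fun x y : E => x ≤ y ∧ A (ε x) (ε y) ≠ 0) a b

/-- A full heap: a fibred labelled heap such that, between two consecutive elements with the
same label `p`, the numbers `A p (ε c)` sum up to `-2`. -/
structure IsFullHeap {P E : Type*} [PartialOrder E] (A : Matrix P P ℤ) (ε : E → P) : Prop
    extends IsLabelledHeap A ε where
  fibre_nonempty : ∀ p : P, ∃ a : E, ε a = p
  fibre_unbounded_above : ∀ a : E, ∃ b : E, ε b = ε a ∧ a < b
  fibre_unbounded_below : ∀ a : E, ∃ b : E, ε b = ε a ∧ b < a
  exists_covering : ∀ (a : E) (q : P), q ≠ ε a → A (ε a) q ≠ 0 →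
    ∃ b : E, ε b = q ∧ (a ⋖ b ∨ b ⋖ a)
  sum_eq : ∀ a b : E, a < b → ε a = ε b → (∀ c ∈ Set.Ioo a b, ε c ≠ ε a) →
    ∑ᶠ c ∈ Set.Ioo a b, A (ε a) (ε c) = -2

/-- A rank function on a poset. -/
def IsRankFunction {E : Type*} [PartialOrder E] (r : E → ℤ) : Prop :=
  ∀ a b : E, a ⋖ b → r b = r a + 1

/-- A proper ideal: a lower set which meets the fibre of every label in a nonempty proper subset
of that fibre. -/
structure IsProperIdeal {P E : Type*} [PartialOrder E] (ε : E → P) (F : Set E) : Prop where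
  isLowerSet : IsLowerSet F
  exists_mem : ∀ p : P, ∃ a ∈ F, ε a = p
  exists_notMem : ∀ p : P, ∃ a ∉ F, ε a = p

/-- The set (lattice) of all proper ideals. -/
def ProperIdeals {P E : Type*} [PartialOrder E] (ε : E → P) : Type _ :=
  {F : Set E // IsProperIdeal ε F}

/-- The elements labelled `p` that can be added to `F` giving an ideal (at most one). -/
def addable {P E : Type*} [PartialOrder E] (ε : E → P) (p : P) (F : Set E) : Set E :=
  {a | ε a = p ∧ a ∉ F ∧ IsLowerSet (F ∪ {a})}

/-- The elements labelled `p` that can be removed from `F` giving an ideal (at most one). -/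
def removable {P E : Type*} [PartialOrder E] (ε : E → P) (p : P) (F : Set E) : Set E :=
  {a | ε a = p ∧ a ∈ F ∧ IsLowerSet (F \ {a})}

open Classical in
/-- The operator `S_p` on ideals: it removes the removable element labelled `p` if there is one,
it adds the addable element labelled `p` if there is one, and it fixes the ideal otherwise. -/
noncomputable def idealReflection {P E : Type*} [PartialOrder E] (ε : E → P) (p : P)
    (F : Set E) : Set E :=
  if (removable ε p F).Nonempty then F \ removable ε p F
  else if (addable ε p F).Nonempty then F ∪ addable ε p F
  else F

end GeneralHeaps

section TypeA

/-- The generalized Cartan matrix of type `A_{2l-1}^{(1)}`, with vertices indexed by `ℤ/2l`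
(a cycle with `2l` vertices; for `l = 1` the off-diagonal entries are `-2`). -/
def affineCartan (l : ℕ) : Matrix (ZMod (2 * l)) (ZMod (2 * l)) ℤ :=
  fun i j => if i = j then 2 else -((if j = i + 1 then 1 else 0) + (if j = i - 1 then 1 else 0))

theorem affineCartan_symm (l : ℕ) (i j : ZMod (2 * l)) :
    affineCartan l i j = affineCartan l j i := by
  have h1 : (j = i + 1) ↔ (i = j - 1) :=
    ⟨fun h => by rw [h]; ring, fun h => by rw [h]; ring⟩
  have h2 : (j = i - 1) ↔ (i = j + 1) :=
    ⟨fun h => by rw [h]; ring, fun h => by rw [h]; ring⟩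
  unfold affineCartan
  by_cases h : i = j
  · simp [h]
  · rw [if_neg h, if_neg (Ne.symm h)]
    simp only [h1, h2]
    ring

/-- The Coxeter matrix of the Weyl group attached to the Cartan matrix: the order of `s_i s_j`
(`i ≠ j`) is `2` if `a_ij = 0`, is `3` if `a_ij a_ji = 1`, and no relation is imposed (entry `0`)
if `a_ij a_ji = 4`. -/
def affineCoxeterMatrix (l : ℕ) : CoxeterMatrix (ZMod (2 * l)) where
  M := fun i j => if i = j then 1 else if affineCartan l i j = 0 then 2
    else if affineCartan l i j * affineCartan l j i = 1 then 3 else 0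
  isSymm := Matrix.IsSymm.ext fun i j => by
    rw [affineCartan_symm l j i]
    simp only [eq_comm (a := j) (b := i)]
  diagonal := fun i => by simp
  off_diagonal := fun i j h => by
    rw [if_neg h]
    split_ifs <;> norm_num

/-- The affine Weyl group `W` of type `A_{2l-1}^{(1)}`. -/
abbrev AffineWeyl (l : ℕ) : Type := (affineCoxeterMatrix l).Group

/-- The generators `s_i` of `W`. -/
def sGen (l : ℕ) (i : ZMod (2 * l)) : AffineWeyl l := (affineCoxeterMatrix l).simple i

/-- The finite Weyl group `W_0`: the subgroup of `W` generated by the `s_i` with `i ≠ 0`. -/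
def finiteWeyl (l : ℕ) : Subgroup (AffineWeyl l) :=
  Subgroup.closure {w | ∃ i : ZMod (2 * l), i ≠ 0 ∧ w = sGen l i}

/-- The generator `s_i`, `i ≠ 0`, as an element of `W_0`. -/
def sGenFinite (l : ℕ) (i : ZMod (2 * l)) (hi : i ≠ 0) : finiteWeyl l :=
  ⟨sGen l i, Subgroup.subset_closure ⟨i, hi, rfl⟩⟩

/-- The elements of the heap `E` over the diagram of type `A_{2l-1}^{(1)}`: the `k`-th layer
consists of one element for each vertex of the same parity as `k`. -/
@[ext]
structure HeapA (l : ℕ) where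
  /-- the vertex that labels the element -/
  label : ZMod (2 * l)
  /-- the layer of the element -/
  layer : ℤ
  parity : ZMod.castHom (dvd_mul_right 2 l) (ZMod 2) label = (layer : ZMod 2)

/-- Two elements of `E` with equal or adjacent labels are related if the first one lies in a
lower layer. -/
def HeapA.Below {l : ℕ} (a b : HeapA l) : Prop :=
  affineCartan l a.label b.label ≠ 0 ∧ a.layer < b.layer

theorem HeapA.eq_or_layer_lt {l : ℕ} {a b : HeapA l}
    (h : Relation.ReflTransGen HeapA.Below a b) : a = b ∨ a.layer < b.layer := by
  induction h with
  | refl => exact Or.inl rfl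
  | tail _ hbc ih =>
    rcases ih with rfl | ih
    · exact Or.inr hbc.2
    · exact Or.inr (ih.trans hbc.2)

/-- The heap order: the order generated by the comparabilities between elements with equal or
adjacent labels. -/
instance HeapA.instPartialOrder (l : ℕ) : PartialOrder (HeapA l) where
  le := Relation.ReflTransGen HeapA.Below
  le_refl := fun _ => Relation.ReflTransGen.refl
  le_trans := fun _ _ _ h1 h2 => h1.trans h2
  le_antisymm := fun a b h1 h2 => by
    rcases HeapA.eq_or_layer_lt h1 with h | h
    · exact h
    · rcases HeapA.eq_or_layer_lt h2 with h' | h'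
      · exact h'.symm
      · exact absurd h (lt_asymm h')

/-- The lattice `ℬ` of proper ideals of `E`. -/
abbrev IdealsA (l : ℕ) : Type := ProperIdeals (HeapA.label : HeapA l → ZMod (2 * l))

/-- The `t`-th power of the periodicity automorphism `φ` of `E`, which moves every element two
layers up. -/
def HeapA.shift {l : ℕ} (t : ℤ) (a : HeapA l) : HeapA l where
  label := a.label
  layer := a.layer + 2 * t
  parity := by
    have h2 : (2 : ZMod 2) = 0 := by decide
    rw [a.parity]
    push_cast
    rw [h2]
    ring

/-- The element `E(0, t)` of `E`: the elements labelled `0` are those in the even layers. -/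
def HeapA.zeroElt (l : ℕ) (t : ℤ) : HeapA l where
  label := 0
  layer := 2 * t
  parity := by
    have h2 : (2 : ZMod 2) = 0 := by decide
    rw [map_zero]
    push_cast
    rw [h2, zero_mul]

/-- `g(F, i) = max {y : (i, y) ∈ F} + 1`, the binary path of the ideal `F`.  For a proper ideal
`F` the set is nonempty and bounded above, so that its supremum is its maximum. -/
noncomputable def pathOf {l : ℕ} (F : Set (HeapA l)) (i : ZMod (2 * l)) : ℤ :=
  sSup {y : ℤ | ∃ a ∈ F, a.label = i ∧ a.layer = y} + 1

/-- The alphabet `{+, -}`. -/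
inductive PlusMinus where
  | plus : PlusMinus
  | minus : PlusMinus
  deriving DecidableEq

/-- The balanced cyclic strings: functions `ℤ/2l → {+, -}` taking both values equally often. -/
def BalancedString (l : ℕ) : Type :=
  {x : ZMod (2 * l) → PlusMinus //
    {i | x i = PlusMinus.plus}.ncard = {i | x i = PlusMinus.minus}.ncard}

/-- The string of a path `f`: the letter in position `i` records whether `f` goes up or down in
the step from `i` to `i + 1`. -/
noncomputable def stringOfPath {l : ℕ} (f : ZMod (2 * l) → ℤ) : ZMod (2 * l) → PlusMinus :=
  fun i => if f i < f (i + 1) then PlusMinus.plus else PlusMinus.minus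

/-- The string obtained by exchanging the symbols in positions `i` and `j`. -/
def BalancedString.exchange {l : ℕ} (i j : ZMod (2 * l)) (x : BalancedString l) :
    BalancedString l :=
  ⟨x.1 ∘ Equiv.swap i j, by
    have key : ∀ c : PlusMinus,
        {k | (x.1 ∘ Equiv.swap i j) k = c}.ncard = {k | x.1 k = c}.ncard := fun c =>
      Set.ncard_preimage_of_injective_subset_range (s := {k | x.1 k = c})
        (Equiv.swap i j).injective (fun k _ => (Equiv.swap i j).surjective k)
    rw [key, key]
    exact x.2⟩

end TypeA

/-! A proper ideal is determined by its upper boundary, an integer function `g` on the cycle with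
steps `±1` and prescribed parity (`idealEquivPath`). Removing or adding an element labelled `i`
flips a peak or a valley of `g`, and in every case `S_i` becomes the linear map replacing `g i` by
`g (i + 1) + g (i - 1) - g i` (`IsBinaryPath.idealReflection_pathIdeal`). This is the simple
reflection on the root lattice, `g` being a coordinate vector in the simple roots. The Coxeter
relations are therefore checked in the geometric representation (`affineCoxeterMatrix_isLiftable`),
which preserves the set of paths.

Faithfulness is that of the geometric representation (`latticeRep_injective`, by the usual
positivity of roots), because differences of paths contain a nonzero multiple of every simple root
(`eq_one_of_fixes_paths`).

A path amounts to its value at `0` and its string of steps (`pathEquivString`). Reflecting at `i`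
interchanges the steps into and out of `i` (`stringOfPath_latticeReflection`), and only `s_0`
changes the value at `0`. Hence `W_0` acts on strings alone: transitively, since adjacent
transpositions generate the symmetric group, and faithfully, since it does not move the integer. -/

/-! ### Parity and adjacency on the cycle. -/

instance instNeZeroTwoMul (l : ℕ) [NeZero l] : NeZero (2 * l) :=
  ⟨mul_ne_zero two_ne_zero (NeZero.ne l)⟩

instance instNontrivialZModTwoMul (l : ℕ) : Nontrivial (ZMod (2 * l)) :=
  (ZMod.castHom (dvd_mul_right 2 l) (ZMod 2)).domain_nontrivial

/-- The parity of a vertex of the cycle of length `2l`. -/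
abbrev vertexParity (l : ℕ) : ZMod (2 * l) →+* ZMod 2 :=
  ZMod.castHom (dvd_mul_right 2 l) (ZMod 2)

theorem vertexParity_add_one (l : ℕ) (i : ZMod (2 * l)) :
    vertexParity l (i + 1) = vertexParity l i + 1 := by
  rw [map_add, map_one]

theorem vertexParity_sub_one (l : ℕ) (i : ZMod (2 * l)) :
    vertexParity l (i - 1) = vertexParity l i + 1 := by
  rw [map_sub, map_one, sub_eq_add_neg]
  congr 1

theorem ne_add_one (l : ℕ) (i : ZMod (2 * l)) : i ≠ i + 1 := by
  simp

theorem ne_sub_one (l : ℕ) (i : ZMod (2 * l)) : i ≠ i - 1 := by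
  intro h
  have h2 : i - 1 = i := h.symm
  simp at h2

theorem affineCartan_self (l : ℕ) (i : ZMod (2 * l)) : affineCartan l i i = 2 := by
  simp [affineCartan]

theorem affineCartan_ne_zero_iff (l : ℕ) (i j : ZMod (2 * l)) :
    affineCartan l i j ≠ 0 ↔ j = i ∨ j = i + 1 ∨ j = i - 1 := by
  unfold affineCartan
  by_cases h : i = j
  · simp [h]
  · rw [if_neg h]
    have h' : j ≠ i := Ne.symm h
    split_ifs <;> simp_all

theorem int_cast_add_one_zmod_two (k : ℤ) : ((k + 1 : ℤ) : ZMod 2) = (k : ZMod 2) + 1 := by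
  push_cast; rfl

theorem int_cast_sub_one_zmod_two (k : ℤ) : ((k - 1 : ℤ) : ZMod 2) = (k : ZMod 2) + 1 := by
  rw [Int.cast_sub, Int.cast_one, sub_eq_add_neg]
  congr 1

/-! ### The full heap and its rank function. -/

namespace HeapA

variable {l : ℕ}

theorem layer_emod_eq {a b : HeapA l} (h : a.label = b.label) : a.layer % 2 = b.layer % 2 := by
  have := a.parity
  rw [h, b.parity] at this
  exact ((ZMod.intCast_eq_intCast_iff' _ _ 2).1 this).symm

theorem layer_emod_eq_of_adj {a b : HeapA l} (h : b.label = a.label + 1 ∨ b.label = a.label - 1) :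
    (a.layer + 1) % 2 = b.layer % 2 := by
  have hb := b.parity
  have ha := a.parity
  apply (ZMod.intCast_eq_intCast_iff' _ _ 2).1
  rw [← hb, int_cast_add_one_zmod_two, ← ha]
  rcases h with h | h
  · rw [h, vertexParity_add_one]
  · rw [h, vertexParity_sub_one]

/-- The element labelled `q` in the layer above `a`, for a neighbour `q` of the label of `a`. -/
def above (a : HeapA l) (q : ZMod (2 * l)) (hq : q = a.label + 1 ∨ q = a.label - 1) :
    HeapA l where
  label := q
  layer := a.layer + 1
  parity := by
    rw [int_cast_add_one_zmod_two, ← a.parity]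
    rcases hq with rfl | rfl
    · rw [vertexParity_add_one]
    · rw [vertexParity_sub_one]

theorem le_of_below {a b : HeapA l} (h : Below a b) : a ≤ b :=
  Relation.ReflTransGen.single h

theorem lt_of_below {a b : HeapA l} (h : Below a b) : a < b :=
  lt_of_le_of_ne (le_of_below h) fun h2 => (ne_of_lt h.2) (by rw [h2])

theorem layer_lt_of_lt {a b : HeapA l} (h : a < b) : a.layer < b.layer :=
  (eq_or_layer_lt h.le).resolve_left h.ne

theorem layer_le_of_le {a b : HeapA l} (h : a ≤ b) : a.layer ≤ b.layer := by
  rcases eq_or_layer_lt h with rfl | h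
  · exact le_rfl
  · exact h.le

theorem exists_below_le_of_lt {a b : HeapA l} (h : a < b) : ∃ c, Below a c ∧ c ≤ b := by
  rcases Relation.ReflTransGen.cases_head h.le with h1 | ⟨c, hc, hcb⟩
  · exact absurd h1 h.ne
  · exact ⟨c, hc, hcb⟩

theorem below_of_lt_of_layer_eq {a b : HeapA l} (h : a < b) (hl : b.layer = a.layer + 1) :
    Below a b := by
  obtain ⟨c, hac, hcb⟩ := exists_below_le_of_lt h
  rcases eq_or_layer_lt hcb with rfl | h2
  · exact hac
  · have := hac.2
    omega

theorem covBy_of_lt_of_layer_eq {a b : HeapA l} (h : a < b) (hl : b.layer = a.layer + 1) :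
    a ⋖ b := by
  refine ⟨h, fun c hac hcb => ?_⟩
  have h1 := layer_lt_of_lt hac
  have h2 := layer_lt_of_lt hcb
  omega

theorem below_above (a : HeapA l) (q : ZMod (2 * l)) (hq : q = a.label + 1 ∨ q = a.label - 1) :
    Below a (a.above q hq) :=
  ⟨(affineCartan_ne_zero_iff l _ _).2 (Or.inr hq), lt_add_one a.layer⟩

/-- A covering pair is a single generating relation. If it skipped a layer, an element just above
`a` would fit in between: one with a neighbouring label if the two labels agree, one with the upper
label otherwise. -/
theorem isRankFunction_layer : IsRankFunction (HeapA.layer : HeapA l → ℤ) := by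
  intro a b hab
  obtain ⟨c, hac, hcb⟩ := exists_below_le_of_lt hab.1
  obtain rfl : c = b := by
    by_contra hne
    exact hab.2 (lt_of_below hac) (lt_of_le_of_ne hcb hne)
  have hlt := hac.2
  by_contra hne
  rcases (affineCartan_ne_zero_iff l _ _).1 hac.1 with h | h
  · refine hab.2 (lt_of_below (below_above a (a.label + 1) (Or.inl rfl))) (lt_of_below ⟨?_, ?_⟩)
    · rw [affineCartan_ne_zero_iff]
      right; right
      rw [h]
      simp [above]
    · simp only [above]
      omega
  · have h2 := layer_emod_eq_of_adj h
    refine hab.2 (lt_of_below (below_above a c.label h)) (lt_of_below ⟨?_, ?_⟩)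
    · simp [above, affineCartan_self]
    · simp only [above]
      omega

theorem sum_between (a b : HeapA l) (hab : a < b) (h : a.label = b.label)
    (hc : ∀ c ∈ Set.Ioo a b, c.label ≠ a.label) :
    ∑ᶠ c ∈ Set.Ioo a b, affineCartan l a.label c.label = -2 := by
  have hmod := layer_emod_eq h
  have hlt := layer_lt_of_lt hab
  have hb : b.layer = a.layer + 2 := by
    by_contra hne
    let c : HeapA l := a.shift 1
    have hac : a < c := lt_of_below ⟨by simp [c, shift, affineCartan_self], by simp [c, shift]⟩
    have hcb : c < b := lt_of_below ⟨by simp [c, shift, ← h, affineCartan_self], by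
      simp only [c, shift]; omega⟩
    exact hc c ⟨hac, hcb⟩ rfl
  let u := a.above (a.label + 1) (Or.inl rfl)
  let v := a.above (a.label - 1) (Or.inr rfl)
  have hIoo : Set.Ioo a b = {u, v} := by
    ext c
    simp only [Set.mem_Ioo, Set.mem_insert_iff, Set.mem_singleton_iff]
    constructor
    · rintro ⟨hac, hcb⟩
      have h1 := layer_lt_of_lt hac
      have h2 := layer_lt_of_lt hcb
      have h3 : c.layer = a.layer + 1 := by omega
      have h4 := below_of_lt_of_layer_eq hac h3
      rcases (affineCartan_ne_zero_iff l _ _).1 h4.1 with h5 | h5 | h5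
      · exact absurd h5 (hc c ⟨hac, hcb⟩)
      · exact Or.inl (HeapA.ext h5 h3)
      · exact Or.inr (HeapA.ext h5 h3)
    · rintro (rfl | rfl)
      · refine ⟨lt_of_below (below_above _ _ _), lt_of_below ⟨?_, ?_⟩⟩
        · rw [affineCartan_ne_zero_iff, ← h]
          right; right
          simp [u, above]
        · simp only [u, above]; omega
      · refine ⟨lt_of_below (below_above _ _ _), lt_of_below ⟨?_, ?_⟩⟩
        · rw [affineCartan_ne_zero_iff, ← h]
          right; left
          simp [v, above]
        · simp only [v, above]; omega
  rw [hIoo]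
  -- The two neighbours coincide for `l = 1`: then one element contributes `-2`, instead of two
  -- contributing `-1` each.
  by_cases huv : a.label + 1 = a.label - 1
  · have : u = v := HeapA.ext huv rfl
    rw [this, Set.pair_eq_singleton, finsum_mem_singleton]
    simp only [v, above, affineCartan, if_neg (ne_sub_one l a.label), if_pos huv.symm]
    norm_num
  · have : u ≠ v := fun h => huv (congrArg HeapA.label h)
    rw [finsum_mem_pair this]
    simp only [u, v, above, affineCartan, if_neg (ne_sub_one l a.label), if_neg huv,
      if_neg (ne_add_one l a.label), if_neg (Ne.symm huv)]
    norm_num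

theorem isFullHeap [NeZero l] :
    IsFullHeap (affineCartan l) (HeapA.label : HeapA l → ZMod (2 * l)) where
  locallyFinite a b := by
    have hinj : Function.Injective (fun c : HeapA l => (c.label, c.layer)) := fun c d h =>
      HeapA.ext (congrArg Prod.fst h) (congrArg Prod.snd h)
    refine Set.Finite.of_finite_image (f := fun c : HeapA l => (c.label, c.layer)) ?_
      hinj.injOn
    refine ((Set.finite_univ (α := ZMod (2 * l))).prod (Set.finite_Icc a.layer b.layer)).subset ?_
    rintro _ ⟨c, hc, rfl⟩
    exact ⟨Set.mem_univ _, layer_le_of_le hc.1, layer_le_of_le hc.2⟩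
  comparable a b h := by
    rcases lt_trichotomy a.layer b.layer with h1 | h1 | h1
    · exact Or.inl (le_of_below ⟨h, h1⟩)
    · left
      rcases (affineCartan_ne_zero_iff l _ _).1 h with h2 | h2
      · exact le_of_eq (HeapA.ext h2.symm h1)
      · have := layer_emod_eq_of_adj h2
        omega
    · exact Or.inr (le_of_below ⟨by rwa [affineCartan_symm], h1⟩)
  generated a b h := by
    -- A transitive closure needs at least one step; the trivial step from `a` to itself covers `a =
    -- b`.
    refine Relation.TransGen.head' (b := a) ⟨le_rfl, by simp [affineCartan_self]⟩ ?_
    have h' : Relation.ReflTransGen Below a b := h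
    induction h' with
    | refl => exact .refl
    | tail h1 h2 ih => exact (ih h1).tail ⟨le_of_below h2, h2.1⟩
  fibre_nonempty p := ⟨⟨p, p.val, by
    conv_lhs => rw [← ZMod.natCast_zmod_val p]
    rw [map_natCast, Int.cast_natCast]⟩, rfl⟩
  fibre_unbounded_above a := ⟨a.shift 1, rfl, lt_of_below
    ⟨by simp [shift, affineCartan_self], by simp [shift]⟩⟩
  fibre_unbounded_below a := ⟨a.shift (-1), rfl, lt_of_below
    ⟨by simp [shift, affineCartan_self], by simp [shift]⟩⟩
  exists_covering a q hq h := by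
    have h' := ((affineCartan_ne_zero_iff l _ _).1 h).resolve_left hq
    exact ⟨a.above q h', rfl,
      Or.inl (covBy_of_lt_of_layer_eq (lt_of_below (below_above a q h')) rfl)⟩
  sum_eq := sum_between

end HeapA

/-! ### Proper ideals as binary paths. -/

/-- The binary paths: integer labellings of the cycle of length `2l` with steps `±1` and with the
parity that makes the elements `(i, g i - 1)` belong to the heap. -/
structure IsBinaryPath {l : ℕ} (g : ZMod (2 * l) → ℤ) : Prop where
  parity : ∀ i, vertexParity l i = ((g i + 1 : ℤ) : ZMod 2)
  step : ∀ i, g (i + 1) = g i + 1 ∨ g (i + 1) = g i - 1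

/-- The set of all heap elements strictly below a path. -/
def pathIdeal {l : ℕ} (g : ZMod (2 * l) → ℤ) : Set (HeapA l) :=
  {a | a.layer < g a.label}

section Paths

variable {l : ℕ} {g : ZMod (2 * l) → ℤ}

theorem mem_pathIdeal {a : HeapA l} : a ∈ pathIdeal g ↔ a.layer < g a.label := Iff.rfl

theorem HeapA.layer_emod_eq_of_parity (a : HeapA l)
    (h : ∀ i, vertexParity l i = ((g i + 1 : ℤ) : ZMod 2)) :
    a.layer % 2 = (g a.label + 1) % 2 :=
  (ZMod.intCast_eq_intCast_iff' _ _ 2).1 (a.parity.symm.trans (h a.label))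

theorem IsBinaryPath.step_sub (hg : IsBinaryPath g) (i : ZMod (2 * l)) :
    g (i - 1) = g i + 1 ∨ g (i - 1) = g i - 1 := by
  have := hg.step (i - 1)
  rw [sub_add_cancel] at this
  omega

/-- The heap element immediately below the path at the vertex `i`. -/
def IsBinaryPath.top (hg : IsBinaryPath g) (i : ZMod (2 * l)) : HeapA l where
  label := i
  layer := g i - 1
  parity := by
    rw [int_cast_sub_one_zmod_two, ← int_cast_add_one_zmod_two]
    exact hg.parity i

/-- Along a generating relation downwards the layer drops by at least one, while the path drops by
at most one. -/
theorem IsBinaryPath.isLowerSet_pathIdeal (hg : IsBinaryPath g) : IsLowerSet (pathIdeal g) := by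
  intro b a hab hb
  have hab' : Relation.ReflTransGen HeapA.Below a b := hab
  induction hab' with
  | refl => exact hb
  | @tail c d h1 h2 ih =>
    refine ih h1 ?_
    rw [mem_pathIdeal] at hb ⊢
    have h3 := h2.2
    have h4 := d.layer_emod_eq_of_parity hg.parity
    rcases (affineCartan_ne_zero_iff l _ _).1 h2.1 with h5 | h5 | h5
    · rw [h5] at hb
      omega
    · have := hg.step c.label
      rw [h5] at hb h4
      omega
    · have := hg.step_sub c.label
      rw [h5] at hb h4
      omega

theorem IsBinaryPath.isGreatest_layer (hg : IsBinaryPath g) (i : ZMod (2 * l)) :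
    IsGreatest {y : ℤ | ∃ a ∈ pathIdeal g, a.label = i ∧ a.layer = y} (g i - 1) := by
  refine ⟨⟨hg.top i, ?_, rfl, rfl⟩, ?_⟩
  · simp [mem_pathIdeal, top]
  · rintro _ ⟨a, ha, rfl, rfl⟩
    rw [mem_pathIdeal] at ha
    omega

theorem IsBinaryPath.pathOf_pathIdeal (hg : IsBinaryPath g) : pathOf (pathIdeal g) = g := by
  funext i
  rw [pathOf, (hg.isGreatest_layer i).csSup_eq]
  ring

theorem IsBinaryPath.isProperIdeal_pathIdeal (hg : IsBinaryPath g) :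
    IsProperIdeal HeapA.label (pathIdeal g) where
  isLowerSet := hg.isLowerSet_pathIdeal
  exists_mem p := ⟨hg.top p, by simp [mem_pathIdeal, top], rfl⟩
  exists_notMem p := ⟨(hg.top p).shift 1, by simp only [mem_pathIdeal, top, HeapA.shift]; omega, rfl⟩

namespace IsProperIdeal

variable {F : Set (HeapA l)}

theorem mem_of_label_eq_of_layer_le (hF : IsProperIdeal HeapA.label F) {a b : HeapA l} (hb : b ∈ F) (h : a.label = b.label)
    (hle : a.layer ≤ b.layer) : a ∈ F := by
  rcases hle.eq_or_lt with h1 | h1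
  · rwa [HeapA.ext h h1]
  · exact hF.isLowerSet (HeapA.le_of_below ⟨by rw [h, affineCartan_self]; norm_num, h1⟩) hb

/-- Each fibre is a chain, so an element of it outside `F` bounds the part inside `F`; the supremum
is then attained. -/
theorem isGreatest_pathOf (hF : IsProperIdeal HeapA.label F) (i : ZMod (2 * l)) :
    IsGreatest {y : ℤ | ∃ a ∈ F, a.label = i ∧ a.layer = y} (pathOf F i - 1) := by
  obtain ⟨a, haF, hai⟩ := hF.exists_mem i
  obtain ⟨b, hbF, hbi⟩ := hF.exists_notMem i
  have hne : {y : ℤ | ∃ a ∈ F, a.label = i ∧ a.layer = y}.Nonempty := ⟨_, a, haF, hai, rfl⟩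
  have hbdd : BddAbove {y : ℤ | ∃ a ∈ F, a.label = i ∧ a.layer = y} := by
    refine ⟨b.layer, ?_⟩
    rintro _ ⟨c, hcF, hci, rfl⟩
    by_contra hlt
    exact hbF (hF.mem_of_label_eq_of_layer_le hcF (hbi.trans hci.symm) (not_le.1 hlt).le)
  rw [pathOf, add_sub_cancel_right]
  exact ⟨Int.csSup_mem hne hbdd, fun y hy => le_csSup hbdd hy⟩

theorem pathIdeal_pathOf (hF : IsProperIdeal HeapA.label F) : pathIdeal (pathOf F) = F := by
  ext a
  rw [mem_pathIdeal]
  obtain ⟨⟨b, hbF, hbl, hby⟩, hub⟩ := hF.isGreatest_pathOf a.label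
  constructor
  · intro h
    exact hF.mem_of_label_eq_of_layer_le hbF hbl.symm (by omega)
  · intro h
    have := hub ⟨a, h, rfl, rfl⟩
    omega

theorem parity_pathOf (hF : IsProperIdeal HeapA.label F) (i : ZMod (2 * l)) :
    vertexParity l i = ((pathOf F i + 1 : ℤ) : ZMod 2) := by
  obtain ⟨⟨b, hbF, hbl, hby⟩, -⟩ := hF.isGreatest_pathOf i
  rw [int_cast_add_one_zmod_two, ← int_cast_sub_one_zmod_two, ← hby, ← b.parity, hbl]

theorem pathOf_sub_one_le (hF : IsProperIdeal HeapA.label F) (i j : ZMod (2 * l)) (h : j = i + 1 ∨ j = i - 1) :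
    pathOf F i - 1 ≤ pathOf F j := by
  obtain ⟨⟨b, hbF, rfl, hby⟩, -⟩ := hF.isGreatest_pathOf i
  -- This is the element labelled `j` one layer below `b`.
  have hmem : (b.above j h).shift (-1) ∈ F := by
    refine hF.isLowerSet (HeapA.le_of_below ⟨?_, ?_⟩) hbF
    · rw [affineCartan_symm, affineCartan_ne_zero_iff]
      exact Or.inr h
    · simp only [HeapA.shift, HeapA.above]
      omega
  have := (hF.isGreatest_pathOf j).2 ⟨_, hmem, rfl, rfl⟩
  simp only [HeapA.shift, HeapA.above] at this
  omega

theorem isBinaryPath_pathOf (hF : IsProperIdeal HeapA.label F) : IsBinaryPath (pathOf F) where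
  parity := hF.parity_pathOf
  step i := by
    have h1 := hF.pathOf_sub_one_le i (i + 1) (Or.inl rfl)
    have h2 := hF.pathOf_sub_one_le (i + 1) i (Or.inr (by simp))
    have h3 : pathOf F (i + 1) % 2 = (pathOf F i + 1) % 2 := by
      apply (ZMod.intCast_eq_intCast_iff' _ _ 2).1
      rw [← hF.parity_pathOf i]
      have := hF.parity_pathOf (i + 1)
      rw [vertexParity_add_one, int_cast_add_one_zmod_two] at this
      exact (add_right_cancel this).symm
    -- The two inequalities bound the step by one in absolute value, and parity excludes zero.
    omega

end IsProperIdeal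

/-- Proper ideals correspond to binary paths. -/
noncomputable def idealEquivPath (l : ℕ) : IdealsA l ≃ {g : ZMod (2 * l) → ℤ // IsBinaryPath g} where
  toFun F := ⟨pathOf F.1, F.2.isBinaryPath_pathOf⟩
  invFun g := ⟨pathIdeal g.1, g.2.isProperIdeal_pathIdeal⟩
  left_inv F := Subtype.ext F.2.pathIdeal_pathOf
  right_inv g := Subtype.ext g.2.pathOf_pathIdeal

/-! ### The operators on ideals as lattice reflections. -/

/-- The reflection of the root lattice (in the basis of simple roots) in the simple root `i`. -/
def latticeReflection (l : ℕ) (i : ZMod (2 * l)) : Module.End ℤ (ZMod (2 * l) → ℤ) where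
  toFun g := Function.update g i (g (i + 1) + g (i - 1) - g i)
  map_add' f g := by
    funext k
    by_cases h : k = i
    · subst h
      simp
      ring
    · simp [h]
  map_smul' c g := by
    funext k
    by_cases h : k = i
    · subst h
      simp
      ring
    · simp [h]

theorem latticeReflection_apply (i k : ZMod (2 * l)) (g : ZMod (2 * l) → ℤ) :
    latticeReflection l i g k = if k = i then g (i + 1) + g (i - 1) - g i else g k := by
  simp [latticeReflection, Function.update_apply]

theorem latticeReflection_apply_self (i : ZMod (2 * l)) (g : ZMod (2 * l) → ℤ) :
    latticeReflection l i g i = g (i + 1) + g (i - 1) - g i := by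
  simp [latticeReflection_apply]

theorem latticeReflection_apply_of_ne {i k : ZMod (2 * l)} (h : k ≠ i) (g : ZMod (2 * l) → ℤ) :
    latticeReflection l i g k = g k := by
  simp [latticeReflection_apply, h]

/-- The new value at `i` differs from one neighbouring value by exactly what the other neighbouring
value differed from the old one, that is by `±1`. -/
theorem IsBinaryPath.latticeReflection (hg : IsBinaryPath g) (i : ZMod (2 * l)) :
    IsBinaryPath (latticeReflection l i g) where
  parity k := by
    rw [hg.parity k]
    apply (ZMod.intCast_eq_intCast_iff' _ _ 2).2
    rw [latticeReflection_apply]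
    have h1 := hg.step i
    have h2 := hg.step_sub i
    split_ifs with h
    · subst h
      omega
    · rfl
  step k := by
    have h1 := hg.step k
    have h2 := hg.step_sub k
    have h3 := hg.step (k + 1)
    have hk := ne_add_one l k
    rw [latticeReflection_apply, latticeReflection_apply]
    split_ifs with h h' h'
    · exact absurd (h'.trans h.symm) hk
    · subst h
      rw [add_sub_cancel_right]
      omega
    · subst h'
      omega
    · exact h1

theorem IsBinaryPath.mem_removable_iff (hg : IsBinaryPath g) (i : ZMod (2 * l)) (a : HeapA l) :
    a ∈ removable HeapA.label i (pathIdeal g) ↔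
      a.label = i ∧ a.layer = g i - 1 ∧ g (i + 1) = g i - 1 ∧ g (i - 1) = g i - 1 := by
  constructor
  · rintro ⟨rfl, ha, hlow⟩
    have key : ∀ b : HeapA l, HeapA.Below a b → b ∈ pathIdeal g → False := fun b hab hb =>
      (hlow (HeapA.le_of_below hab) ⟨hb, (HeapA.lt_of_below hab).ne'⟩).2 rfl
    have htop : a.layer = g a.label - 1 := by
      by_contra hne
      rw [mem_pathIdeal] at ha
      refine key (hg.top a.label) ⟨by simp [IsBinaryPath.top, affineCartan_self], ?_⟩ ?_
      · simp only [IsBinaryPath.top]; omega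
      · simp [mem_pathIdeal, IsBinaryPath.top]
    refine ⟨rfl, htop, ?_, ?_⟩
    · refine (hg.step a.label).resolve_left fun h => ?_
      refine key _ (HeapA.below_above a (a.label + 1) (Or.inl rfl)) ?_
      simp only [mem_pathIdeal, HeapA.above]
      omega
    · refine (hg.step_sub a.label).resolve_left fun h => ?_
      refine key _ (HeapA.below_above a (a.label - 1) (Or.inr rfl)) ?_
      simp only [mem_pathIdeal, HeapA.above]
      omega
  · rintro ⟨rfl, h1, h2, h3⟩
    refine ⟨rfl, by rw [mem_pathIdeal]; omega, ?_⟩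
    -- Deleting the element under a peak leaves the elements below the reflected path, already known
    -- to form a lower set.
    convert (hg.latticeReflection a.label).isLowerSet_pathIdeal using 1
    ext b
    simp only [Set.mem_sdiff, Set.mem_singleton_iff, mem_pathIdeal]
    by_cases hb : b.label = a.label
    · have hm := HeapA.layer_emod_eq hb
      have : b = a ↔ b.layer = a.layer := ⟨fun h => by rw [h], fun h => HeapA.ext hb h⟩
      rw [this, hb, latticeReflection_apply_self]
      omega
    · rw [latticeReflection_apply_of_ne hb]
      have : b ≠ a := fun h => hb (by rw [h])
      tauto

theorem IsBinaryPath.mem_addable_iff (hg : IsBinaryPath g) (i : ZMod (2 * l)) (a : HeapA l) :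
    a ∈ addable HeapA.label i (pathIdeal g) ↔
      a.label = i ∧ a.layer = g i + 1 ∧ g (i + 1) = g i + 1 ∧ g (i - 1) = g i + 1 := by
  constructor
  · rintro ⟨rfl, ha, hlow⟩
    have key : ∀ b : HeapA l, HeapA.Below b a → b ∈ pathIdeal g := fun b hab =>
      (hlow (HeapA.le_of_below hab) (Or.inr rfl)).resolve_right (HeapA.lt_of_below hab).ne
    have hm := a.layer_emod_eq_of_parity hg.parity
    have htop : a.layer = g a.label + 1 := by
      by_contra hne
      rw [mem_pathIdeal] at ha
      have := key ((hg.top a.label).shift 1)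
        ⟨by simp [IsBinaryPath.top, affineCartan_self, HeapA.shift], by
          simp only [IsBinaryPath.top, HeapA.shift]; omega⟩
      simp only [mem_pathIdeal, IsBinaryPath.top, HeapA.shift] at this
      omega
    refine ⟨rfl, htop, ?_, ?_⟩
    · refine (hg.step a.label).resolve_right fun h => ?_
      have := key ((a.above (a.label + 1) (Or.inl rfl)).shift (-1)) ⟨by
        rw [affineCartan_symm, affineCartan_ne_zero_iff]; exact Or.inr (Or.inl rfl), by
        simp only [HeapA.shift, HeapA.above]; omega⟩
      simp only [mem_pathIdeal, HeapA.above, HeapA.shift] at this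
      omega
    · refine (hg.step_sub a.label).resolve_right fun h => ?_
      have := key ((a.above (a.label - 1) (Or.inr rfl)).shift (-1)) ⟨by
        rw [affineCartan_symm, affineCartan_ne_zero_iff]; exact Or.inr (Or.inr rfl), by
        simp only [HeapA.shift, HeapA.above]; omega⟩
      simp only [mem_pathIdeal, HeapA.above, HeapA.shift] at this
      omega
  · rintro ⟨rfl, h1, h2, h3⟩
    refine ⟨rfl, by rw [mem_pathIdeal]; omega, ?_⟩
    convert (hg.latticeReflection a.label).isLowerSet_pathIdeal using 1
    ext b
    simp only [Set.mem_union, Set.mem_singleton_iff, mem_pathIdeal]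
    by_cases hb : b.label = a.label
    · have hm := HeapA.layer_emod_eq hb
      have : b = a ↔ b.layer = a.layer := ⟨fun h => by rw [h], fun h => HeapA.ext hb h⟩
      rw [this, hb, latticeReflection_apply_self]
      omega
    · rw [latticeReflection_apply_of_ne hb]
      have : b ≠ a := fun h => hb (by rw [h])
      tauto

/-- The operator `S_i` on ideals is the reflection of the root lattice on paths. -/
theorem IsBinaryPath.idealReflection_pathIdeal (hg : IsBinaryPath g) (i : ZMod (2 * l)) :
    idealReflection HeapA.label i (pathIdeal g) = pathIdeal (_root_.latticeReflection l i g) := by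
  have h1 := hg.step i
  have h2 := hg.step_sub i
  unfold idealReflection
  split_ifs with hr ha
  · obtain ⟨a, ha⟩ := hr
    obtain ⟨-, -, h3, h4⟩ := (hg.mem_removable_iff i a).1 ha
    ext b
    rw [Set.mem_sdiff, hg.mem_removable_iff, mem_pathIdeal, mem_pathIdeal]
    by_cases hb : b.label = i
    · have hm := b.layer_emod_eq_of_parity hg.parity
      subst hb
      rw [latticeReflection_apply_self]
      simp only [true_and]
      omega
    · simp [hb, latticeReflection_apply_of_ne hb]
  · obtain ⟨a, ha⟩ := ha
    obtain ⟨-, -, h3, h4⟩ := (hg.mem_addable_iff i a).1 ha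
    ext b
    rw [Set.mem_union, hg.mem_addable_iff, mem_pathIdeal, mem_pathIdeal]
    by_cases hb : b.label = i
    · have hm := b.layer_emod_eq_of_parity hg.parity
      subst hb
      rw [latticeReflection_apply_self]
      simp only [true_and]
      omega
    · simp [hb, latticeReflection_apply_of_ne hb]
  -- With neither a peak nor a valley at `i`, the neighbouring values are `g i + 1` and `g i - 1`,
  -- and the reflection fixes `g`.
  · have h5 : ¬(g (i + 1) = g i - 1 ∧ g (i - 1) = g i - 1) := fun h =>
      hr ⟨hg.top i, (hg.mem_removable_iff i _).2 ⟨rfl, rfl, h⟩⟩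
    have h6 : ¬(g (i + 1) = g i + 1 ∧ g (i - 1) = g i + 1) := fun h =>
      ha ⟨(hg.top i).shift 1, (hg.mem_addable_iff i _).2 ⟨rfl, by
        simp only [HeapA.shift, top]; ring, h⟩⟩
    congr 1
    funext k
    rw [latticeReflection_apply]
    split_ifs with hk
    · subst hk
      omega
    · rfl

end Paths

/-! ### The geometric representation and its faithfulness. -/

section Lattice

variable {l : ℕ}

/-- The pairing with the simple coroot `i` on the root lattice. -/
def corootPairing (l : ℕ) (i : ZMod (2 * l)) : (ZMod (2 * l) → ℤ) →ₗ[ℤ] ℤ :=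
  (2 : ℤ) • LinearMap.proj i - LinearMap.proj (i + 1) - LinearMap.proj (i - 1)

theorem corootPairing_apply (i : ZMod (2 * l)) (g : ZMod (2 * l) → ℤ) :
    corootPairing l i g = 2 * g i - g (i + 1) - g (i - 1) := by
  simp [corootPairing]

theorem corootPairing_single (i j : ZMod (2 * l)) :
    corootPairing l i (Pi.single j 1) = affineCartan l i j := by
  rw [corootPairing_apply, affineCartan]
  by_cases h : i = j
  · subst h
    simp [(ne_add_one l i).symm, (ne_sub_one l i).symm]
  · simp only [Pi.single_apply, h, if_false, eq_comm (a := j)]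
    ring

theorem corootPairing_const (i : ZMod (2 * l)) (c : ℤ) :
    corootPairing l i (fun _ => c) = 0 := by
  rw [corootPairing_apply]
  ring

/-- In this form the Coxeter relations reduce to linear algebra with the Cartan entries. -/
theorem latticeReflection_eq_sub (i : ZMod (2 * l)) (g : ZMod (2 * l) → ℤ) :
    latticeReflection l i g = g - corootPairing l i g • Pi.single i 1 := by
  funext k
  rw [latticeReflection_apply, corootPairing_apply]
  by_cases h : k = i
  · subst h
    simp
    ring
  · simp [h]

theorem latticeReflection_single (i j : ZMod (2 * l)) :
    latticeReflection l i (Pi.single j 1) =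
      Pi.single j 1 - affineCartan l i j • Pi.single i 1 := by
  rw [latticeReflection_eq_sub, corootPairing_single]

theorem latticeReflection_mul_self (i : ZMod (2 * l)) :
    latticeReflection l i * latticeReflection l i = 1 := by
  refine LinearMap.ext fun g => ?_
  rw [Module.End.mul_apply, Module.End.one_apply]
  simp only [latticeReflection_eq_sub, map_sub, map_smul, corootPairing_single, affineCartan_self]
  module

theorem affineCartan_of_mul_eq_one {i j : ZMod (2 * l)} (hij : i ≠ j)
    (h : affineCartan l i j * affineCartan l j i = 1) : affineCartan l i j = -1 := by
  rw [affineCartan_symm l j i, affineCartan, if_neg hij] at h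
  rw [affineCartan, if_neg hij]
  split_ifs at h ⊢ <;> simp_all

theorem latticeReflection_commute {i j : ZMod (2 * l)} (h : affineCartan l i j = 0) :
    latticeReflection l i * latticeReflection l j =
      latticeReflection l j * latticeReflection l i := by
  refine LinearMap.ext fun g => ?_
  have h' : affineCartan l j i = 0 := by rw [affineCartan_symm, h]
  rw [Module.End.mul_apply, Module.End.mul_apply]
  simp only [latticeReflection_eq_sub, map_sub, map_smul, corootPairing_single, h, h']
  module

theorem latticeReflection_braid {i j : ZMod (2 * l)} (h : affineCartan l i j = -1) :
    latticeReflection l i * latticeReflection l j * latticeReflection l i =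
      latticeReflection l j * latticeReflection l i * latticeReflection l j := by
  refine LinearMap.ext fun g => ?_
  have h' : affineCartan l j i = -1 := by rw [affineCartan_symm, h]
  simp only [Module.End.mul_apply]
  simp only [latticeReflection_eq_sub, map_sub, map_smul, corootPairing_single, h, h',
    affineCartan_self]
  module

theorem affineCoxeterMatrix_isLiftable (l : ℕ) :
    (affineCoxeterMatrix l).IsLiftable (latticeReflection l) := by
  intro i j
  change (latticeReflection l i * latticeReflection l j) ^
    (if i = j then 1 else if affineCartan l i j = 0 then 2
      else if affineCartan l i j * affineCartan l j i = 1 then 3 else 0) = 1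
  have hi := latticeReflection_mul_self i
  have hj := latticeReflection_mul_self j
  split_ifs with h1 h2 h3
  · subst h1
    rw [pow_one, hi]
  · have hc := latticeReflection_commute h2
    rw [Commute.mul_pow hc, pow_two, pow_two, hi, hj, one_mul]
  · have hb := latticeReflection_braid (affineCartan_of_mul_eq_one h1 h3)
    generalize latticeReflection l i = a at *
    generalize latticeReflection l j = b at *
    calc (a * b) ^ 3 = (a * b * a) * (b * a * b) := by simp only [pow_succ, pow_zero, one_mul, mul_assoc]
      _ = (a * b * a) * (a * b * a) := by rw [hb]
      _ = a * (b * (a * a) * b) * a := by simp only [mul_assoc]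
      _ = 1 := by rw [hi, mul_one, hj, mul_one, hi]
  · rw [pow_zero]

/-- The Coxeter system of the affine Weyl group. -/
abbrev affineSystem (l : ℕ) : CoxeterSystem (affineCoxeterMatrix l) (AffineWeyl l) :=
  (affineCoxeterMatrix l).toCoxeterSystem

theorem affineSystem_simple (i : ZMod (2 * l)) : (affineSystem l).simple i = sGen l i := rfl

/-- The geometric representation of the affine Weyl group on the root lattice. -/
noncomputable def latticeRep (l : ℕ) : AffineWeyl l →* Module.End ℤ (ZMod (2 * l) → ℤ) :=
  (affineSystem l).lift ⟨latticeReflection l, affineCoxeterMatrix_isLiftable l⟩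

theorem latticeRep_sGen (i : ZMod (2 * l)) : latticeRep l (sGen l i) = latticeReflection l i :=
  (affineSystem l).lift_apply_simple (affineCoxeterMatrix_isLiftable l) i

theorem sGen_mul_self (i : ZMod (2 * l)) : sGen l i * sGen l i = 1 :=
  (affineSystem l).simple_mul_simple_self i

theorem sGen_commute {i j : ZMod (2 * l)} (hij : i ≠ j) (h : affineCartan l i j = 0) :
    sGen l i * sGen l j = sGen l j * sGen l i := by
  have := (affineSystem l).simple_mul_simple_pow i j
  have hM : affineCoxeterMatrix l i j = 2 := by
    change (if i = j then 1 else if affineCartan l i j = 0 then 2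
      else if affineCartan l i j * affineCartan l j i = 1 then 3 else 0) = 2
    rw [if_neg hij, if_pos h]
  rw [hM, affineSystem_simple, affineSystem_simple, pow_two] at this
  rw [eq_inv_of_mul_eq_one_left this, mul_inv_rev, inv_eq_of_mul_eq_one_left (sGen_mul_self i),
    inv_eq_of_mul_eq_one_left (sGen_mul_self j)]

theorem sGen_braid {i j : ZMod (2 * l)} (h : affineCartan l i j = -1) :
    sGen l i * sGen l j * sGen l i = sGen l j * sGen l i * sGen l j := by
  have := (affineSystem l).simple_mul_simple_pow i j
  have hM : affineCoxeterMatrix l i j = 3 := by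
    change (if i = j then 1 else if affineCartan l i j = 0 then 2
      else if affineCartan l i j * affineCartan l j i = 1 then 3 else 0) = 3
    rw [if_neg (by rintro rfl; rw [affineCartan_self] at h; norm_num at h),
      affineCartan_symm l j i, h]
    norm_num
  rw [hM, affineSystem_simple, affineSystem_simple] at this
  have h3 : sGen l i * sGen l j * sGen l i * (sGen l j * sGen l i * sGen l j) = 1 := by
    rw [← this]
    simp only [pow_succ, pow_zero, one_mul, mul_assoc]
  rw [eq_inv_of_mul_eq_one_left h3]
  simp only [mul_inv_rev, inv_eq_of_mul_eq_one_left (sGen_mul_self i),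
    inv_eq_of_mul_eq_one_left (sGen_mul_self j), mul_assoc]

/-- Constant functions are the multiples of the null root, on which every simple coroot vanishes. -/
theorem latticeRep_const (w : AffineWeyl l) (c : ℤ) :
    latticeRep l w (fun _ => c) = fun _ => c := by
  induction w using (affineSystem l).simple_induction with
  | simple i =>
    rw [affineSystem_simple, latticeRep_sGen, latticeReflection_eq_sub, corootPairing_const,
      zero_smul, sub_zero]
  | one => rw [map_one, Module.End.one_apply]
  | mul w w' h h' => rw [map_mul, Module.End.mul_apply, h', h]

/-- The remaining off-diagonal entry is `-2`. It forces `l = 1`, where the sum of the two simple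
roots is the null root. -/
theorem single_add_single_of_affineCartan {i j : ZMod (2 * l)} (hij : i ≠ j)
    (h0 : affineCartan l i j ≠ 0) (h1 : affineCartan l i j ≠ -1) :
    affineCartan l i j = -2 ∧ (Pi.single i 1 + Pi.single j 1 : ZMod (2 * l) → ℤ) = fun _ => 1 := by
  rw [affineCartan, if_neg hij] at h0 h1 ⊢
  have h : j = i + 1 ∧ j = i - 1 := by
    split_ifs at h0 h1 <;> simp_all
  rw [if_pos h.1, if_pos h.2]
  refine ⟨by norm_num, ?_⟩
  have h2 : ((2 : ℕ) : ZMod (2 * l)) = 0 := by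
    have := h.1.symm.trans h.2
    push_cast
    linear_combination this
  rw [ZMod.natCast_eq_zero_iff] at h2
  obtain rfl : l = 1 := Nat.dvd_one.1 (Nat.dvd_of_mul_dvd_mul_left two_pos h2)
  have hall : ∀ i j : ZMod (2 * 1), i ≠ j → ∀ k,
      (Pi.single i 1 + Pi.single j 1 : ZMod (2 * 1) → ℤ) k = 1 := by decide
  exact funext (hall i j hij)

/-- If `s_i` is not a right descent of `w`, then `w` maps the simple root `i` to a positive root. -/
theorem latticeRep_single_nonneg (n : ℕ) : ∀ (w : AffineWeyl l) (i : ZMod (2 * l)),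
    (affineSystem l).length w = n → ¬(affineSystem l).IsRightDescent w i →
      0 ≤ latticeRep l w (Pi.single i 1) := by
  induction n using Nat.strong_induction_on with
  | _ n ih =>
  intro w i hn hi
  by_cases hw : w = 1
  · subst hw
    rw [map_one, Module.End.one_apply]
    exact Pi.single_nonneg.2 zero_le_one
  -- Write `w = v s_j` with `v` shorter. The image of the root `i` under `s_j` is a nonnegative
  -- combination of the roots `i` and `j`, and `v` keeps the root `j` positive by induction.
  obtain ⟨j, hj⟩ := (affineSystem l).exists_rightDescent_of_ne_one hw
  have hij : j ≠ i := fun h => hi (h ▸ hj)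
  obtain ⟨v, rfl⟩ : ∃ v, w = v * sGen l j := ⟨w * sGen l j, by
    rw [mul_assoc, sGen_mul_self, mul_one]⟩
  rw [CoxeterSystem.not_isRightDescent_iff, affineSystem_simple] at hi
  rw [CoxeterSystem.isRightDescent_iff, affineSystem_simple, mul_assoc, sGen_mul_self,
    mul_one] at hj
  have hvj : 0 ≤ latticeRep l v (Pi.single j 1) := by
    refine ih _ (by omega) v j rfl ?_
    rw [CoxeterSystem.not_isRightDescent_iff, affineSystem_simple]
    omega
  rw [map_mul, Module.End.mul_apply, latticeRep_sGen, latticeReflection_single]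
  have hlen := (affineSystem l).length_mul_simple
  simp only [affineSystem_simple] at hlen
  by_cases h0 : affineCartan l j i = 0
  · rw [h0, zero_smul, sub_zero]
    refine ih _ (by omega) v i rfl ?_
    rw [CoxeterSystem.not_isRightDescent_iff, affineSystem_simple]
    rw [mul_assoc, sGen_commute hij h0, ← mul_assoc] at hi
    have h1 := hlen v i
    have h2 := hlen (v * sGen l i) j
    omega
  by_cases h1 : affineCartan l j i = -1
  · rw [h1, neg_smul, one_smul, sub_neg_eq_add, map_add]
    -- If `v = u s_i` with `u` shorter, then `s_i s_j` sends the root `i` to the root `j`, so `u` is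
    -- applied to the root `j`. The braid relation shows that `j` is no right descent of `u`.
    by_cases hvi : (affineSystem l).IsRightDescent v i
    · obtain ⟨u, rfl⟩ : ∃ u, v = u * sGen l i := ⟨v * sGen l i, by
        rw [mul_assoc, sGen_mul_self, mul_one]⟩
      rw [CoxeterSystem.isRightDescent_iff, affineSystem_simple, mul_assoc, sGen_mul_self,
        mul_one] at hvi
      rw [← map_add, map_mul, Module.End.mul_apply, latticeRep_sGen, map_add,
        latticeReflection_single, latticeReflection_single, affineCartan_self,
        affineCartan_symm l i j, h1]
      have hsum : (Pi.single i 1 - (2 : ℤ) • Pi.single i 1 +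
          (Pi.single j 1 - (-1 : ℤ) • Pi.single i 1) : ZMod (2 * l) → ℤ) = Pi.single j 1 := by
        module
      rw [hsum]
      refine ih _ (by omega) u j rfl ?_
      rw [CoxeterSystem.not_isRightDescent_iff, affineSystem_simple]
      have hb : u * sGen l i * sGen l j * sGen l i = u * sGen l j * sGen l i * sGen l j := by
        have := sGen_braid (l := l) (i := i) (j := j) (by rw [affineCartan_symm, h1])
        simp only [mul_assoc] at this ⊢
        rw [this]
      rw [hb] at hi
      have h2 := hlen u j
      have h3 := hlen (u * sGen l j) i
      have h4 := hlen (u * sGen l j * sGen l i) j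
      omega
    · exact add_nonneg (ih _ (by omega) v i rfl hvi) hvj
  -- Here `s_j` maps the root `i` to the null root plus the root `j`, and the null root is fixed by
  -- `v`.
  · obtain ⟨h2, h3⟩ := single_add_single_of_affineCartan hij h0 h1
    have h4 : (Pi.single i 1 - (-2 : ℤ) • Pi.single j 1 : ZMod (2 * l) → ℤ) =
        (fun _ => 1) + Pi.single j 1 := by
      rw [← h3]
      module
    rw [h2, h4, map_add, latticeRep_const]
    exact add_nonneg (fun _ => zero_le_one) hvj

/-- The geometric representation is faithful. -/
theorem latticeRep_injective (l : ℕ) : Function.Injective (latticeRep l) := by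
  rw [injective_iff_map_eq_one]
  intro w hw
  by_contra hne
  obtain ⟨i, hi⟩ := (affineSystem l).exists_rightDescent_of_ne_one hne
  rw [CoxeterSystem.isRightDescent_iff_not_isRightDescent_mul, affineSystem_simple] at hi
  -- As `w` acts trivially, `w s_i` sends the root `i` to its negative, contradicting positivity.
  have h := latticeRep_single_nonneg _ (w * sGen l i) i rfl hi i
  rw [map_mul, Module.End.mul_apply, hw, Module.End.one_apply, latticeRep_sGen,
    latticeReflection_apply_self] at h
  simp [(ne_add_one l i).symm, (ne_sub_one l i).symm] at h

theorem IsBinaryPath.latticeRep {g : ZMod (2 * l) → ℤ} (hg : IsBinaryPath g) (w : AffineWeyl l) :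
    IsBinaryPath (latticeRep l w g) := by
  induction w using (affineSystem l).simple_induction_left with
  | one => rwa [map_one, Module.End.one_apply]
  | mul_simple_left w i h =>
    rw [affineSystem_simple, map_mul, Module.End.mul_apply, latticeRep_sGen]
    exact h.latticeReflection i

/-- The path of the ideal of all elements in layers at most `0`. -/
def zigzagPath (l : ℕ) (i : ZMod (2 * l)) : ℤ :=
  if vertexParity l i = 0 then 1 else 0

theorem isBinaryPath_zigzagPath (l : ℕ) : IsBinaryPath (zigzagPath l) where
  parity i := by
    rw [zigzagPath]
    generalize vertexParity l i = z
    revert z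
    decide
  step i := by
    rw [zigzagPath, zigzagPath, vertexParity_add_one]
    generalize vertexParity l i = z
    revert z
    decide

/-- The zigzag path has a peak or a valley at every vertex, so the pairing is `±2`. -/
theorem corootPairing_zigzagPath_ne_zero (i : ZMod (2 * l)) :
    corootPairing l i (zigzagPath l) ≠ 0 := by
  rw [corootPairing_apply]
  simp only [zigzagPath, vertexParity_add_one, vertexParity_sub_one]
  generalize vertexParity l i = z
  revert z
  decide

/-- An element of the affine Weyl group that fixes all paths is trivial. -/
theorem eq_one_of_fixes_paths [NeZero l] (w : AffineWeyl l)
    (h : ∀ g, IsBinaryPath g → latticeRep l w g = g) : w = 1 := by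
  apply latticeRep_injective l
  rw [map_one]
  refine LinearMap.pi_ext fun i c => ?_
  have h1 := h _ (isBinaryPath_zigzagPath l)
  have h2 := h _ ((isBinaryPath_zigzagPath l).latticeReflection i)
  -- The two fixed paths differ by a nonzero multiple of the simple root `i`, which is thus fixed as
  -- well.
  rw [latticeReflection_eq_sub, map_sub, h1, sub_right_inj, map_smul] at h2
  have h3 := smul_right_injective _ (corootPairing_zigzagPath_ne_zero i) h2
  have h4 : (Pi.single i c : ZMod (2 * l) → ℤ) = c • Pi.single i 1 := by
    rw [← Pi.single_smul, smul_eq_mul, mul_one]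
  rw [h4, map_smul, h3, Module.End.one_apply]

end Lattice

/-! ### Paths as an integer and a balanced string. -/

theorem ZMod.induction_add_one {n : ℕ} [NeZero n] {p : ZMod n → Prop} (zero : p 0)
    (succ : ∀ i, p i → p (i + 1)) (i : ZMod n) : p i := by
  rw [← ZMod.natCast_zmod_val i]
  induction i.val with
  | zero => rwa [Nat.cast_zero]
  | succ k ih =>
    rw [Nat.cast_succ]
    exact succ _ ih

/-- The integer `±1` given by a symbol. -/
def PlusMinus.sign : PlusMinus → ℤ
  | .plus => 1
  | .minus => -1

theorem PlusMinus.sum_sign_eq {ι : Type*} [Fintype ι] (x : ι → PlusMinus) :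
    ∑ i, (x i).sign = ({i | x i = .plus}.ncard : ℤ) - ({i | x i = .minus}.ncard : ℤ) := by
  classical
  have key : ∀ c : PlusMinus, ({i | x i = c}.ncard : ℤ) = ∑ i, if x i = c then 1 else 0 := by
    intro c
    rw [Set.ncard_eq_toFinset_card', Finset.sum_boole]
    simp
  rw [key, key, ← Finset.sum_sub_distrib]
  refine Finset.sum_congr rfl fun i _ => ?_
  cases x i <;> simp [PlusMinus.sign]

section Strings

variable {l : ℕ}

theorem IsBinaryPath.apply_add_one {g : ZMod (2 * l) → ℤ} (hg : IsBinaryPath g)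
    (i : ZMod (2 * l)) : g (i + 1) = g i + (stringOfPath g i).sign := by
  rw [stringOfPath]
  rcases hg.step i with h | h
  · rw [if_pos (by omega), h]
    rfl
  · rw [if_neg (by omega), h]
    rfl

/-- The steps around the cycle add up to zero. -/
theorem IsBinaryPath.balanced [NeZero l] {g : ZMod (2 * l) → ℤ} (hg : IsBinaryPath g) :
    {i | stringOfPath g i = PlusMinus.plus}.ncard =
      {i | stringOfPath g i = PlusMinus.minus}.ncard := by
  have h := PlusMinus.sum_sign_eq (stringOfPath g)
  have h2 : ∑ i, (stringOfPath g i).sign = ∑ i, (g (i + 1) - g i) :=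
    Finset.sum_congr rfl fun i _ => by rw [hg.apply_add_one]; ring
  have h3 : ∑ i, g (i + 1) = ∑ i, g i := Equiv.sum_comp (Equiv.addRight (1 : ZMod (2 * l))) g
  rw [h2, Finset.sum_sub_distrib, h3, sub_self] at h
  omega

theorem IsBinaryPath.apply_zero_emod {g : ZMod (2 * l) → ℤ} (hg : IsBinaryPath g) :
    g 0 % 2 = 1 := by
  have h := hg.parity 0
  rw [map_zero, ← Int.cast_zero] at h
  have := (ZMod.intCast_eq_intCast_iff' _ _ 2).1 h
  omega

/-- The path with a given string and the value `2 t + 1` at `0`. -/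
noncomputable def pathOfString (t : ℤ) (x : ZMod (2 * l) → PlusMinus) (i : ZMod (2 * l)) : ℤ :=
  2 * t + 1 + ∑ j ∈ Finset.range i.val, (x j).sign

theorem pathOfString_zero (t : ℤ) (x : ZMod (2 * l) → PlusMinus) :
    pathOfString t x 0 = 2 * t + 1 := by
  simp [pathOfString]

/-- Balance is needed at the last vertex only, where the path has to close up to its value at `0`.
-/
theorem pathOfString_add_one [NeZero l] (t : ℤ) (x : BalancedString l) (i : ZMod (2 * l)) :
    pathOfString t x.1 (i + 1) = pathOfString t x.1 i + (x.1 i).sign := by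
  have hval : (i + 1).val = (i.val + 1) % (2 * l) := by
    rw [← ZMod.val_natCast, Nat.cast_succ, ZMod.natCast_zmod_val]
  have hlt := ZMod.val_lt i
  have hsum : ∑ j ∈ Finset.range (i.val + 1), (x.1 j).sign =
      ∑ j ∈ Finset.range i.val, (x.1 j).sign + (x.1 i).sign := by
    rw [Finset.sum_range_succ, ZMod.natCast_zmod_val]
  rw [pathOfString, pathOfString, hval, add_assoc (2 * t + 1), ← hsum]
  rcases (Nat.succ_le_of_lt hlt).lt_or_eq with h | h
  · rw [Nat.mod_eq_of_lt h]
  · rw [Nat.succ_eq_add_one] at h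
    rw [h, Nat.mod_self, Finset.range_zero, Finset.sum_empty]
    have htotal : ∑ j ∈ Finset.range (2 * l), (x.1 j).sign = ∑ i, (x.1 i).sign :=
      Finset.sum_nbij' (fun j => (j : ZMod (2 * l))) ZMod.val (fun _ _ => Finset.mem_univ _)
        (fun k _ => Finset.mem_range.2 (ZMod.val_lt k))
        (fun j hj => ZMod.val_cast_of_lt (Finset.mem_range.1 hj))
        (fun k _ => ZMod.natCast_zmod_val k) (fun _ _ => rfl)
    rw [htotal, PlusMinus.sum_sign_eq, x.2, sub_self]

theorem isBinaryPath_pathOfString [NeZero l] (t : ℤ) (x : BalancedString l) :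
    IsBinaryPath (pathOfString t x.1) where
  step i := by
    rw [pathOfString_add_one]
    cases x.1 i <;> simp [PlusMinus.sign, sub_eq_add_neg]
  parity i := by
    induction i using ZMod.induction_add_one with
    | zero =>
      rw [map_zero, ← Int.cast_zero, pathOfString_zero]
      apply (ZMod.intCast_eq_intCast_iff' _ _ 2).2
      omega
    | succ i ih =>
      rw [vertexParity_add_one, ih, ← int_cast_add_one_zmod_two, pathOfString_add_one]
      apply (ZMod.intCast_eq_intCast_iff' _ _ 2).2
      cases x.1 i
      · rfl
      · simp only [PlusMinus.sign]
        omega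

theorem stringOfPath_pathOfString [NeZero l] (t : ℤ) (x : BalancedString l) :
    stringOfPath (pathOfString t x.1) = x.1 := by
  funext i
  rw [stringOfPath, pathOfString_add_one]
  cases x.1 i <;> simp [PlusMinus.sign]

theorem IsBinaryPath.sub_eq_of_stringOfPath_eq [NeZero l] {f g : ZMod (2 * l) → ℤ}
    (hf : IsBinaryPath f) (hg : IsBinaryPath g) (h : stringOfPath f = stringOfPath g)
    (i : ZMod (2 * l)) : f i - g i = f 0 - g 0 := by
  induction i using ZMod.induction_add_one with
  | zero => rfl
  | succ i ih => rw [hf.apply_add_one, hg.apply_add_one, h, ← ih]; ring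

/-- A path is determined by its value at `0` and its string. -/
noncomputable def pathEquivString (l : ℕ) [NeZero l] :
    {g : ZMod (2 * l) → ℤ // IsBinaryPath g} ≃ ℤ × BalancedString l where
  -- The value at `0` is odd, so the quotient is exact.
  toFun g := ((g.1 0 - 1) / 2, ⟨stringOfPath g.1, g.2.balanced⟩)
  invFun p := ⟨pathOfString p.1 p.2.1, isBinaryPath_pathOfString p.1 p.2⟩
  left_inv g := by
    have h1 := isBinaryPath_pathOfString ((g.1 0 - 1) / 2) ⟨stringOfPath g.1, g.2.balanced⟩
    refine Subtype.ext (funext fun i => sub_eq_zero.1 ?_)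
    have h2 := h1.sub_eq_of_stringOfPath_eq g.2 (stringOfPath_pathOfString _ _) i
    have h3 := g.2.apply_zero_emod
    refine h2.trans ?_
    rw [pathOfString_zero]
    omega
  right_inv p := by
    refine Prod.ext ?_ (Subtype.ext (stringOfPath_pathOfString p.1 p.2))
    simp only [pathOfString_zero]
    omega

/-- Reflection at `i` interchanges the increments of `g` into and out of `i` and leaves the others
alone. -/
theorem stringOfPath_latticeReflection (i : ZMod (2 * l)) (g : ZMod (2 * l) → ℤ) :
    stringOfPath (latticeReflection l i g) = stringOfPath g ∘ Equiv.swap (i - 1) i := by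
  funext k
  have hne := ne_sub_one l i
  have hne' := ne_add_one l i
  by_cases h1 : k = i
  · subst h1
    simp only [Function.comp, stringOfPath, Equiv.swap_apply_right, sub_add_cancel]
    rw [latticeReflection_apply_self, latticeReflection_apply_of_ne hne'.symm]
    exact if_congr (by omega) rfl rfl
  · by_cases h2 : k = i - 1
    · subst h2
      simp only [Function.comp, stringOfPath, Equiv.swap_apply_left, sub_add_cancel]
      rw [latticeReflection_apply_self, latticeReflection_apply_of_ne h1]
      exact if_congr (by omega) rfl rfl
    · have h3 : k + 1 ≠ i := fun h => h2 (eq_sub_of_add_eq h)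
      simp only [Function.comp, stringOfPath, Equiv.swap_apply_of_ne_of_ne h2 h1,
        latticeReflection_apply_of_ne h1, latticeReflection_apply_of_ne h3]

/-! ### The induced actions of the affine Weyl group. -/

/-- The action of the affine Weyl group on binary paths. -/
noncomputable def pathRep (l : ℕ) :
    AffineWeyl l →* Equiv.Perm {g : ZMod (2 * l) → ℤ // IsBinaryPath g} :=
  MonoidHom.toHomPerm
    { toFun := fun w g => ⟨latticeRep l w g.1, g.2.latticeRep w⟩
      map_one' := by
        funext g
        exact Subtype.ext (LinearMap.congr_fun (map_one (latticeRep l)) g.1)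
      map_mul' := fun w w' => by
        funext g
        exact Subtype.ext (LinearMap.congr_fun (map_mul (latticeRep l) w w') g.1) }

/-- The action of the affine Weyl group on proper ideals. -/
noncomputable def idealRep (l : ℕ) : AffineWeyl l →* Equiv.Perm (IdealsA l) :=
  (idealEquivPath l).symm.permCongrHom.toMonoidHom.comp (pathRep l)

theorem idealEquivPath_idealRep (w : AffineWeyl l) (F : IdealsA l) :
    idealEquivPath l (idealRep l w F) = pathRep l w (idealEquivPath l F) :=
  (idealEquivPath l).apply_symm_apply _

theorem idealRep_sGen (i : ZMod (2 * l)) (F : IdealsA l) :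
    (idealRep l (sGen l i) F).1 = idealReflection HeapA.label i F.1 := by
  obtain ⟨g, rfl⟩ := (idealEquivPath l).symm.surjective F
  rw [← (idealEquivPath l).symm_apply_apply (idealRep l (sGen l i) _), idealEquivPath_idealRep,
    Equiv.apply_symm_apply]
  refine Eq.trans ?_ (g.2.idealReflection_pathIdeal i).symm
  change pathIdeal (latticeRep l (sGen l i) g.1) = _
  rw [latticeRep_sGen]

section

variable [NeZero l]

/-- The action of the affine Weyl group on pairs of an integer and a balanced string. -/
noncomputable def pairRep (l : ℕ) [NeZero l] : AffineWeyl l →* Equiv.Perm (ℤ × BalancedString l) :=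
  (pathEquivString l).permCongrHom.toMonoidHom.comp (pathRep l)

theorem pairRep_pathEquivString (w : AffineWeyl l)
    (g : {g : ZMod (2 * l) → ℤ // IsBinaryPath g}) :
    pairRep l w (pathEquivString l g) = pathEquivString l (pathRep l w g) := by
  change pathEquivString l (pathRep l w ((pathEquivString l).symm (pathEquivString l g))) = _
  rw [Equiv.symm_apply_apply]

theorem pairRep_injective (l : ℕ) [NeZero l] : Function.Injective (pairRep l) := by
  rw [injective_iff_map_eq_one]
  intro w hw
  refine eq_one_of_fixes_paths w fun g hg => ?_
  have h := pairRep_pathEquivString w ⟨g, hg⟩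
  rw [hw, Equiv.Perm.one_apply] at h
  exact congrArg Subtype.val ((pathEquivString l).injective h).symm

theorem pairRep_sGen_snd (i : ZMod (2 * l)) (p : ℤ × BalancedString l) :
    (pairRep l (sGen l i) p).2 = p.2.exchange (i - 1) i := by
  obtain ⟨g, rfl⟩ := (pathEquivString l).surjective p
  rw [pairRep_pathEquivString]
  apply Subtype.ext
  change stringOfPath (latticeRep l (sGen l i) g.1) = stringOfPath g.1 ∘ Equiv.swap (i - 1) i
  rw [latticeRep_sGen, stringOfPath_latticeReflection]

theorem pairRep_sGen_fst_of_ne {i : ZMod (2 * l)} (hi : i ≠ 0) (p : ℤ × BalancedString l) :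
    (pairRep l (sGen l i) p).1 = p.1 := by
  obtain ⟨g, rfl⟩ := (pathEquivString l).surjective p
  rw [pairRep_pathEquivString]
  change (latticeRep l (sGen l i) g.1 0 - 1) / 2 = (g.1 0 - 1) / 2
  rw [latticeRep_sGen, latticeReflection_apply_of_ne hi.symm]

/-- The value at `0` changes by the step out of `0` minus the step into `0`; doubling avoids the
division by two. -/
theorem pairRep_sGen_zero_fst (p : ℤ × BalancedString l) :
    2 * (pairRep l (sGen l 0) p).1 = 2 * p.1 + (p.2.1 0).sign - (p.2.1 (-1)).sign := by
  obtain ⟨g, rfl⟩ := (pathEquivString l).surjective p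
  rw [pairRep_pathEquivString]
  change 2 * ((latticeRep l (sGen l 0) g.1 0 - 1) / 2) = 2 * ((g.1 0 - 1) / 2) +
    (stringOfPath g.1 0).sign - (stringOfPath g.1 (-1)).sign
  rw [latticeRep_sGen, latticeReflection_apply_self, zero_add, zero_sub]
  have h1 := g.2.apply_add_one 0
  have h2 := g.2.apply_add_one (-1)
  have h3 := g.2.apply_zero_emod
  rw [zero_add] at h1
  rw [neg_add_cancel] at h2
  have hs : ∀ c : PlusMinus, c.sign = 1 ∨ c.sign = -1 := by
    rintro (_ | _) <;> simp [PlusMinus.sign]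
  have h4 := hs (stringOfPath g.1 0)
  have h5 := hs (stringOfPath g.1 (-1))
  omega

/-- This makes the action descend from pairs to strings. -/
theorem pairRep_snd_eq (w : AffineWeyl l) (t t' : ℤ) (x : BalancedString l) :
    (pairRep l w (t, x)).2 = (pairRep l w (t', x)).2 := by
  induction w using (affineSystem l).simple_induction_left with
  | one => rw [map_one, Equiv.Perm.one_apply, Equiv.Perm.one_apply]
  | mul_simple_left w i ih =>
    rw [affineSystem_simple, map_mul, Equiv.Perm.mul_apply, Equiv.Perm.mul_apply, pairRep_sGen_snd,
      pairRep_sGen_snd, ih]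

/-- The action of the affine Weyl group on balanced strings. -/
noncomputable def stringRep (l : ℕ) [NeZero l] : AffineWeyl l →* Equiv.Perm (BalancedString l) :=
  MonoidHom.toHomPerm
    { toFun := fun w x => (pairRep l w (0, x)).2
      map_one' := by
        funext x
        rw [map_one]
        rfl
      map_mul' := fun w w' => by
        funext x
        rw [map_mul, Equiv.Perm.mul_apply]
        exact pairRep_snd_eq w _ _ _ }

theorem pairRep_snd (w : AffineWeyl l) (t : ℤ) (x : BalancedString l) :
    (pairRep l w (t, x)).2 = stringRep l w x :=
  pairRep_snd_eq w t 0 x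

theorem stringRep_sGen (i : ZMod (2 * l)) (x : BalancedString l) :
    stringRep l (sGen l i) x = x.exchange (i - 1) i :=
  pairRep_sGen_snd i (0, x)

theorem pairRep_fst_of_mem_finiteWeyl {w : AffineWeyl l} (hw : w ∈ finiteWeyl l)
    (p : ℤ × BalancedString l) : (pairRep l w p).1 = p.1 := by
  induction hw using Subgroup.closure_induction generalizing p with
  | mem w hw =>
    obtain ⟨i, hi, rfl⟩ := hw
    exact pairRep_sGen_fst_of_ne hi p
  | one => rw [map_one, Equiv.Perm.one_apply]
  | mul w w' _ _ h h' => rw [map_mul, Equiv.Perm.mul_apply, h, h']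
  | inv w _ h =>
    rw [← h (pairRep l w⁻¹ p), ← Equiv.Perm.mul_apply, ← map_mul, mul_inv_cancel, map_one,
      Equiv.Perm.one_apply]

theorem pairRep_of_mem_finiteWeyl {w : AffineWeyl l} (hw : w ∈ finiteWeyl l) (t : ℤ)
    (x : BalancedString l) : pairRep l w (t, x) = (t, stringRep l w x) :=
  Prod.ext (pairRep_fst_of_mem_finiteWeyl hw (t, x)) (pairRep_snd w t x)

/-! ### Transitivity and faithfulness of the finite Weyl group. -/

theorem ZMod.mclosure_swap_sub_one (n : ℕ) [NeZero n] :
    Submonoid.closure {σ : Equiv.Perm (ZMod n) | ∃ i, i ≠ 0 ∧ σ = Equiv.swap (i - 1) i} = ⊤ := by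
  obtain _ | n := n
  · exact absurd rfl (NeZero.ne 0)
  have key : Submonoid.closure
      {σ : Equiv.Perm (Fin (n + 1)) | ∃ i, i ≠ 0 ∧ σ = Equiv.swap (i - 1) i} = ⊤ := by
    rw [eq_top_iff, ← Equiv.Perm.mclosure_swap_castSucc_succ n]
    refine Submonoid.closure_mono ?_
    rintro _ ⟨i, rfl⟩
    refine ⟨i.succ, Fin.succ_ne_zero i, ?_⟩
    have : (i.succ - 1 : Fin (n + 1)) = i.castSucc := by
      rw [sub_eq_iff_eq_add, Fin.coeSucc_eq_succ]
    rw [this]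
  -- `ZMod (n + 1)` is `Fin (n + 1)` by definition.
  exact key

theorem exists_finiteWeyl_stringRep_eq_comp (σ : Equiv.Perm (ZMod (2 * l))) :
    ∃ w ∈ finiteWeyl l, ∀ x : BalancedString l, (stringRep l w x).1 = x.1 ∘ σ := by
  have hσ : σ ∈ Submonoid.closure
      {σ : Equiv.Perm (ZMod (2 * l)) | ∃ i, i ≠ 0 ∧ σ = Equiv.swap (i - 1) i} := by
    rw [ZMod.mclosure_swap_sub_one]
    trivial
  induction hσ using Submonoid.closure_induction with
  | mem σ hσ =>
    obtain ⟨i, hi, rfl⟩ := hσ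
    exact ⟨sGen l i, Subgroup.subset_closure ⟨i, hi, rfl⟩, fun x => by
      rw [stringRep_sGen]; rfl⟩
  | one => exact ⟨1, one_mem _, fun x => by rw [map_one]; rfl⟩
  | mul σ σ' _ _ h h' =>
    obtain ⟨w, hw, hwx⟩ := h
    obtain ⟨w', hw', hwx'⟩ := h'
    -- The order is reversed because permutations act by precomposition.
    refine ⟨w' * w, mul_mem hw' hw, fun x => ?_⟩
    rw [map_mul, Equiv.Perm.mul_apply, hwx', hwx]
    rfl

theorem BalancedString.two_mul_ncard_plus (x : BalancedString l) :
    2 * {i | x.1 i = PlusMinus.plus}.ncard = 2 * l := by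
  have hc : {i | x.1 i = PlusMinus.minus} = {i | x.1 i = PlusMinus.plus}ᶜ := by
    ext i
    cases h : x.1 i <;> simp [h]
  have h := Set.ncard_add_ncard_compl {i | x.1 i = PlusMinus.plus}
  rw [← hc, ← x.2, Nat.card_zmod] at h
  omega

/-- Both strings have `l` plus signs; a bijection between these positions extends to a permutation
of all positions. -/
theorem BalancedString.exists_perm (x y : BalancedString l) :
    ∃ σ : Equiv.Perm (ZMod (2 * l)), y.1 = x.1 ∘ σ := by
  classical
  have hcard : Fintype.card {i // y.1 i = PlusMinus.plus} =
      Fintype.card {i // x.1 i = PlusMinus.plus} := by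
    have h1 := x.two_mul_ncard_plus
    have h2 := y.two_mul_ncard_plus
    rw [← Nat.card_eq_fintype_card, ← Nat.card_eq_fintype_card]
    change {i | y.1 i = PlusMinus.plus}.ncard = {i | x.1 i = PlusMinus.plus}.ncard
    omega
  let e := Fintype.equivOfCardEq hcard
  refine ⟨e.extendSubtype, funext fun i => ?_⟩
  have hm : ∀ c : PlusMinus, c ≠ .plus → c = .minus := by
    rintro (_ | _) h
    · exact absurd rfl h
    · rfl
  by_cases h : y.1 i = PlusMinus.plus
  · rw [h]
    exact (e.extendSubtype_mem i h).symm
  · rw [hm _ h]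
    exact (hm _ (e.extendSubtype_not_mem i h)).symm

theorem exists_finiteWeyl_stringRep_eq (x y : BalancedString l) :
    ∃ w : finiteWeyl l, stringRep l w x = y := by
  obtain ⟨σ, hσ⟩ := x.exists_perm y
  obtain ⟨w, hw, hwx⟩ := exists_finiteWeyl_stringRep_eq_comp (l := l) σ
  exact ⟨⟨w, hw⟩, Subtype.ext ((hwx x).trans hσ.symm)⟩

/-- Elements of `W_0` leave the integer alone, so their action on strings determines their action on
pairs, which is faithful. -/
theorem stringRep_injective_on_finiteWeyl (l : ℕ) [NeZero l] :
    Function.Injective ((stringRep l).comp (finiteWeyl l).subtype) := by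
  intro w w' h
  apply Subtype.ext
  apply pairRep_injective l
  ext1 ⟨t, x⟩
  rw [pairRep_of_mem_finiteWeyl w.2, pairRep_of_mem_finiteWeyl w'.2]
  exact congrArg (Prod.mk t) (DFunLike.congr_fun h x)

/-! ### The bijection `Ψ` and the main theorem. -/

/-- The bijection from proper ideals to pairs of an integer and a balanced string. -/
noncomputable def idealEquivPair (l : ℕ) [NeZero l] : IdealsA l ≃ ℤ × BalancedString l :=
  (idealEquivPath l).trans (pathEquivString l)

theorem idealEquivPair_idealRep (w : AffineWeyl l) (F : IdealsA l) :
    idealEquivPair l (idealRep l w F) = pairRep l w (idealEquivPair l F) := by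
  rw [idealEquivPair, Equiv.trans_apply, Equiv.trans_apply, idealEquivPath_idealRep,
    pairRep_pathEquivString]

theorem isGreatest_idealEquivPair_fst (F : IdealsA l) :
    IsGreatest {t : ℤ | HeapA.zeroElt l t ∈ F.1} (idealEquivPair l F).1 := by
  have hF := F.2.isBinaryPath_pathOf.apply_zero_emod
  have hmem : ∀ t : ℤ, HeapA.zeroElt l t ∈ F.1 ↔ 2 * t < pathOf F.1 0 := fun t => by
    rw [← F.2.pathIdeal_pathOf, F.2.isBinaryPath_pathOf.pathOf_pathIdeal]
    rfl
  change IsGreatest _ ((pathOf F.1 0 - 1) / 2)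
  simp only [hmem]
  refine ⟨?_, fun t ht => ?_⟩
  · rw [Set.mem_ofPred_eq]
    omega
  · rw [Set.mem_ofPred_eq] at ht
    omega

/-- Changing the integer from `0` to `t` raises the whole path by `2 * t`. -/
theorem idealEquivPair_symm_eq_shift (t : ℤ) (x : BalancedString l) :
    ((idealEquivPair l).symm (t, x)).1 =
      HeapA.shift t '' ((idealEquivPair l).symm (0, x)).1 := by
  have hp : pathOfString t x.1 = fun i => pathOfString 0 x.1 i + 2 * t := by
    funext i
    rw [pathOfString, pathOfString]
    ring
  change pathIdeal (pathOfString t x.1) = HeapA.shift t '' pathIdeal (pathOfString 0 x.1)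
  rw [hp]
  ext a
  rw [Set.mem_image, mem_pathIdeal]
  constructor
  · intro h
    refine ⟨a.shift (-t), ?_, HeapA.ext rfl ?_⟩
    · simp only [mem_pathIdeal, HeapA.shift]
      omega
    · simp only [HeapA.shift]
      ring
  · rintro ⟨b, hb, rfl⟩
    rw [mem_pathIdeal] at hb
    simp only [HeapA.shift]
    omega

end

end Strings

theorem proposition8p6 (l : ℕ) (hl : 1 ≤ l) :
    -- `E` is a full heap over the diagram of type `A_{2l-1}^{(1)}`, ranked by its layers
    IsFullHeap (affineCartan l) (HeapA.label : HeapA l → ZMod (2 * l)) ∧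
    IsRankFunction (HeapA.layer : HeapA l → ℤ) ∧
    -- `ρ` is the action of `W` on proper ideals, `Ψ` identifies ideals with pairs `(t, string)`,
    -- `τ₀` and `τ` are the induced actions of `W_0` on strings and of `W` on pairs
    ∃ (ρ : AffineWeyl l →* Equiv.Perm (IdealsA l))
      (Ψ : IdealsA l ≃ ℤ × BalancedString l)
      (τ₀ : finiteWeyl l →* Equiv.Perm (BalancedString l))
      (τ : AffineWeyl l →* Equiv.Perm (ℤ × BalancedString l)),
      (∀ (i : ZMod (2 * l)) (F : IdealsA l),
        (ρ (sGen l i) F).1 = idealReflection HeapA.label i F.1) ∧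
      (∀ F : IdealsA l, IsGreatest {t : ℤ | HeapA.zeroElt l t ∈ F.1} (Ψ F).1 ∧
        (Ψ F).2.1 = stringOfPath (pathOf F.1)) ∧
      (∀ (t : ℤ) (x : BalancedString l),
        (Ψ.symm (t, x)).1 = HeapA.shift t '' (Ψ.symm (0, x)).1) ∧
      -- the induced action of `W_0` on strings is transitive and faithful
      (∀ (w : finiteWeyl l) (F : IdealsA l),
        Ψ (ρ (w : AffineWeyl l) F) = ((Ψ F).1, τ₀ w (Ψ F).2)) ∧
      (∀ x y : BalancedString l, ∃ w : finiteWeyl l, τ₀ w x = y) ∧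
      Function.Injective τ₀ ∧
      (∀ (i : ZMod (2 * l)) (hi : i ≠ 0) (x : BalancedString l),
        τ₀ (sGenFinite l i hi) x = x.exchange (i - 1) i) ∧
      -- the induced action of `W` on pairs extends it and is faithful
      (∀ (w : AffineWeyl l) (F : IdealsA l), τ w (Ψ F) = Ψ (ρ w F)) ∧
      (∀ (w : finiteWeyl l) (t : ℤ) (x : BalancedString l),
        τ (w : AffineWeyl l) (t, x) = (t, τ₀ w x)) ∧
      Function.Injective τ ∧
      (∀ (i : ZMod (2 * l)), i ≠ 0 → ∀ (t : ℤ) (x : BalancedString l),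
        τ (sGen l i) (t, x) = (t, x.exchange (i - 1) i)) ∧
      -- the first symbol is in position `0`, the last one in position `-1 = 2l - 1`
      (∀ (t : ℤ) (x : BalancedString l),
        (x.1 0 = PlusMinus.plus → x.1 (-1) = PlusMinus.minus →
          τ (sGen l 0) (t, x) = (t + 1, x.exchange 0 (-1))) ∧
        (x.1 0 = PlusMinus.minus → x.1 (-1) = PlusMinus.plus →
          τ (sGen l 0) (t, x) = (t - 1, x.exchange 0 (-1))) ∧
        (x.1 0 = x.1 (-1) → τ (sGen l 0) (t, x) = (t, x))) := by
  have : NeZero l := ⟨by omega⟩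
  have hW : ∀ (w : finiteWeyl l) (t : ℤ) (x : BalancedString l),
      pairRep l (w : AffineWeyl l) (t, x) =
        (t, (stringRep l).comp (finiteWeyl l).subtype w x) := fun w t x =>
    pairRep_of_mem_finiteWeyl w.2 t x
  refine ⟨HeapA.isFullHeap, HeapA.isRankFunction_layer, idealRep l, idealEquivPair l,
    (stringRep l).comp (finiteWeyl l).subtype, pairRep l, idealRep_sGen,
    fun F => ⟨isGreatest_idealEquivPair_fst F, rfl⟩, idealEquivPair_symm_eq_shift,
    fun w F => (idealEquivPair_idealRep _ F).trans (hW w _ _), exists_finiteWeyl_stringRep_eq,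
    stringRep_injective_on_finiteWeyl l, fun i _ x => stringRep_sGen i x,
    fun w F => (idealEquivPair_idealRep w F).symm, hW, pairRep_injective l,
    fun i hi t x => Prod.ext (pairRep_sGen_fst_of_ne hi _) (pairRep_sGen_snd i _), ?_⟩
  intro t x
  have h1 := pairRep_sGen_zero_fst (t, x)
  have h2 : (pairRep l (sGen l 0) (t, x)).2 = x.exchange 0 (-1) := by
    rw [pairRep_sGen_snd, zero_sub]
    exact Subtype.ext (congrArg (fun σ : Equiv.Perm (ZMod (2 * l)) => x.1 ∘ σ)
      (Equiv.swap_comm _ _))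
  refine ⟨fun h h' => Prod.ext ?_ h2, fun h h' => Prod.ext ?_ h2, fun h => Prod.ext ?_ ?_⟩
  · simp only [h, h', PlusMinus.sign] at h1
    dsimp only
    omega
  · simp only [h, h', PlusMinus.sign] at h1
    dsimp only
    omega
  · simp only [h] at h1
    dsimp only
    omega
  · rw [h2]
    refine Subtype.ext (funext fun k => ?_)
    change x.1 (Equiv.swap 0 (-1) k) = x.1 k
    rw [Equiv.swap_apply_def]
    split_ifs with hk hk
    · rw [hk, h]
    · rw [hk, h]
    · rfl
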